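/- Let $n\ge 1$ and let $Ty_n$ be classical simple type theory with primitive types $t$ (truth values) and $e_1,\dots,e_n$ (individuals), function types $\alpha\beta$ (functions from $\alpha$ to $\beta$) and product types $\alpha\times\beta$, with terms built from typed variables, non-logical constants and description operators $\iota_{(\alpha t)\alpha}$ by application, abstraction, equality, pairing and projections, and axiomatized as Andrews' system $Q_0$ (extended by several sorts, by pairing axioms, and by $\iota\,(\lambda x_\alpha.\,y_\alpha=x_\alpha)=y_\alpha$ for each type $\alpha$). Let $\mathcal A=\{a_1,\dots,a_N\}$ be a finite alphabet with $N\neq 1$, write $s=e_n$, and suppose that the constants include $\mathbf C^0_s,\mathbf C^1_s,\dots,\mathbf C^N_s$ and a binary operation $+$ on type $s$. Let $Ty_n^{\mathcal A}$ be the extension of $Ty_n$ by the axioms $\forall x_s\,(x+\mathbf C^0=x\wedge \mathbf C^0+x=x)$, $\forall x_s y_s z_s\,((x+y)+z=x+(y+z))$ and $\forall x_s y_s z_s\,(x+\mathbf C^i+y\neq x+\mathbf C^j+z)$ for $1\le i<j\le N$. For a word $w\in\mathcal A^*$ let $T_A(w)$ be the $s$-term given by $T_A(\varepsilon)=\mathbf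 C^0_s$, $T_A(a_i)=\mathbf C^i_s$, $T_A(a_iw)=\mathbf C^i_s+T_A(w)$ for $w\ne\varepsilon$. Fix a type $\alpha$. An $\alpha$-language is a set $\mathcal L$ of pairs $(w,A)$ of a word $w\in\mathcal A^*$ and a (possibly open) term $A$ of type $\alpha$ of $Ty_n^{\mathcal A}$. It is logically closed if $(w,B),(w,C)\in\mathcal L$ and $\vdash A=B\vee A=C$ in $Ty_n^{\mathcal A}$ imply $(w,A)\in\mathcal L$. The logical closure of a language is the least logically closed language that includes it, and a lexicon is the logical closure of a finite $\alpha$-language. Let $Ty_n^{\mathcal A+}$ be any extension of $Ty_n^{\mathcal A}$ by (possibly no) new non-logical constants. A term $L$ of type $s\alpha t$ of $Ty_n^{\mathcal A+}$ represents $\mathcal L$ if, for all words $w$ and all $\alpha$-terms $A$ of $Ty_n^{\mathcal A}$, $$(w,A)\in\mathcal L\iff\ \vdash L\;T_A(w)\;A\quad\text{in } Ty_n^{\mathcal A+}.$$ A canonic representation of $\mathcal L$ is a term $L$ that represents $\mathcal L$ and for which there are $l\ge 0$, words $w_1,\dots,w_l$ and $\alpha$-terms $A_1,\dots,A_l$ of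 $Ty_n^{\mathcal A}$ with $$\vdash L=\lambda x_s\,\lambda y_\alpha\bigl((x=T_A(w_1)\wedge y=A_1)\vee\dots\vee(x=T_A(w_l)\wedge y=A_l)\bigr),$$ where $x,y$ are not free in the $A_i$; the right-hand side is also written $(=T_A(w_1))\times(=A_1)\vee\dots\vee(=T_A(w_l))\times(=A_l)$, and it is $\lambda x_s\lambda y_\alpha\,\mathrm F$ (with $\mathrm F$ falsity) for $l=0$. **Theorem.** A logically closed $\alpha$-language $\mathcal L$ has a canonic representation in $Ty_n^{\mathcal A+}$ if and only if it is a lexicon. Moreover, if $\mathcal L$ is the logical closure of the finite language $\{(w_1,A_1),\dots,(w_l,A_l)\}$, then the term $(=T_A(w_1))\times(=A_1)\vee\dots\vee(=T_A(w_l))\times(=A_l)$ represents $\mathcal L$. -/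

import Mathlib

universe u v

namespace TyN

/-! ### Types and terms of the sorted type theory -/

/-- Types over `n` sorts of individuals: the truth type, the individual types, functional types
(`fn α β` is the type of functions from `α` to `β`) and product types. -/
inductive Ty (n : ℕ) : Type
  | truth : Ty n
  | ind : Fin n → Ty n
  | fn : Ty n → Ty n → Ty n
  | prod : Ty n → Ty n → Ty n

/-- The symbolic type: the last of the `n` individual types. -/
def Ty.sym {n : ℕ} [NeZero n] : Ty n :=
  .ind ⟨n - 1, Nat.sub_lt (NeZero.pos n) Nat.one_pos⟩

/-- Bound variables: typed de Bruijn indices into the list of enclosing binders. -/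
inductive BVar {n : ℕ} : List (Ty n) → Ty n → Type
  | here {Γ : List (Ty n)} {α : Ty n} : BVar (α :: Γ) α
  | there {Γ : List (Ty n)} {α β : Ty n} : BVar Γ α → BVar (β :: Γ) α

/-- Terms with non-logical constants from `C`, inside binders of the types listed in `Γ`. Terms
are taken up to renaming of bound variables, which are de Bruijn indices; the free variables
are the `free α i`, infinitely many for each type. The terms of type `α` proper (open or closed)
are the elements of `Term C [] α`. `iota α` is the description operator. -/
inductive Term {n : ℕ} (C : Ty n → Type u) : List (Ty n) → Ty n → Type u
  | bound {Γ : List (Ty n)} {α : Ty n} : BVar Γ α → Term C Γ α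
  | free {Γ : List (Ty n)} (α : Ty n) (i : ℕ) : Term C Γ α
  | const {Γ : List (Ty n)} {α : Ty n} : C α → Term C Γ α
  | iota {Γ : List (Ty n)} (α : Ty n) : Term C Γ (.fn (.fn α .truth) α)
  | app {Γ : List (Ty n)} {α β : Ty n} : Term C Γ (.fn α β) → Term C Γ α → Term C Γ β
  | lam {Γ : List (Ty n)} {α β : Ty n} : Term C (α :: Γ) β → Term C Γ (.fn α β)
  | eq {Γ : List (Ty n)} {α : Ty n} : Term C Γ α → Term C Γ α → Term C Γ .truth
  | pair {Γ : List (Ty n)} {α β : Ty n} : Term C Γ α → Term C Γ β → Term C Γ (.prod α β)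
  | fst {Γ : List (Ty n)} {α β : Ty n} : Term C Γ (.prod α β) → Term C Γ α
  | snd {Γ : List (Ty n)} {α β : Ty n} : Term C Γ (.prod α β) → Term C Γ β

namespace Term

variable {n : ℕ} {C : Ty n → Type u}

/-! ### Renaming and capture-avoiding substitution of de Bruijn indices -/

/-- Extension of a renaming under one binder. -/
def liftRen {Γ Δ : List (Ty n)} {γ : Ty n} (ρ : ∀ α, BVar Γ α → BVar Δ α) :
    ∀ α, BVar (γ :: Γ) α → BVar (γ :: Δ) α
  | _, .here => .here
  | _, .there x => .there (ρ _ x)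

def rename : ∀ {Γ Δ : List (Ty n)} {α : Ty n}, (∀ β, BVar Γ β → BVar Δ β) →
    Term C Γ α → Term C Δ α
  | _, _, _, ρ, bound x => bound (ρ _ x)
  | _, _, _, _, free α i => free α i
  | _, _, _, _, const c => const c
  | _, _, _, _, iota α => iota α
  | _, _, _, ρ, app A B => app (rename ρ A) (rename ρ B)
  | _, _, _, ρ, lam A => lam (rename (liftRen ρ) A)
  | _, _, _, ρ, eq A B => eq (rename ρ A) (rename ρ B)
  | _, _, _, ρ, pair A B => pair (rename ρ A) (rename ρ B)
  | _, _, _, ρ, fst A => fst (rename ρ A)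
  | _, _, _, ρ, snd A => snd (rename ρ A)

/-- The same term, regarded inside one further binder that does not bind anything in it. -/
def weaken {Γ : List (Ty n)} {α γ : Ty n} (A : Term C Γ α) : Term C (γ :: Γ) α :=
  rename (fun _ x => .there x) A

/-- Extension of a substitution under one binder. -/
def liftSub {Γ Δ : List (Ty n)} {γ : Ty n} (σ : ∀ α, BVar Γ α → Term C Δ α) :
    ∀ α, BVar (γ :: Γ) α → Term C (γ :: Δ) α
  | _, .here => bound .here
  | _, .there x => weaken (σ _ x)

def subst : ∀ {Γ Δ : List (Ty n)} {α : Ty n}, (∀ β, BVar Γ β → Term C Δ β) →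
    Term C Γ α → Term C Δ α
  | _, _, _, σ, bound x => σ _ x
  | _, _, _, _, free α i => free α i
  | _, _, _, _, const c => const c
  | _, _, _, _, iota α => iota α
  | _, _, _, σ, app A B => app (subst σ A) (subst σ B)
  | _, _, _, σ, lam A => lam (subst (liftSub σ) A)
  | _, _, _, σ, eq A B => eq (subst σ A) (subst σ B)
  | _, _, _, σ, pair A B => pair (subst σ A) (subst σ B)
  | _, _, _, σ, fst A => fst (subst σ A)
  | _, _, _, σ, snd A => snd (subst σ A)

/-- The substitution of `B` for the innermost bound variable. -/
def instSub {Γ : List (Ty n)} {γ : Ty n} (B : Term C Γ γ) : ∀ α, BVar (γ :: Γ) α → Term C Γ α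
  | _, .here => B
  | _, .there x => bound x

/-- `A.inst B` is `A` with `B` substituted for the innermost bound variable. -/
def inst {Γ : List (Ty n)} {α γ : Ty n} (A : Term C (γ :: Γ) α) (B : Term C Γ γ) : Term C Γ α :=
  subst (instSub B) A

/-- Translation of terms along a map of constants. -/
def mapConst {C' : Ty n → Type v} (f : ∀ α, C α → C' α) :
    ∀ {Γ : List (Ty n)} {α : Ty n}, Term C Γ α → Term C' Γ α
  | _, _, bound x => bound x
  | _, _, free α i => free α i
  | _, _, const c => const (f _ c)
  | _, _, iota α => iota α
  | _, _, app A B => app (mapConst f A) (mapConst f B)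
  | _, _, lam A => lam (mapConst f A)
  | _, _, eq A B => eq (mapConst f A) (mapConst f B)
  | _, _, pair A B => pair (mapConst f A) (mapConst f B)
  | _, _, fst A => fst (mapConst f A)
  | _, _, snd A => snd (mapConst f A)

/-! ### Logical connectives, defined from equality -/

variable {Γ : List (Ty n)}

/-- `T := (λ x, x) = (λ x, x)`, with `x` of the truth type. -/
def tru : Term C Γ .truth :=
  eq (lam (α := .truth) (bound .here)) (lam (α := .truth) (bound .here))

/-- `∀ x, A := (λ x, T) = (λ x, A)`. -/
def all {α : Ty n} (A : Term C (α :: Γ) .truth) : Term C Γ .truth :=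
  eq (lam tru) (lam A)

/-- `F := ∀ x, x`, with `x` of the truth type. -/
def fls : Term C Γ .truth :=
  all (α := .truth) (bound .here)

/-- `¬ A := (F = A)`. -/
def neg (A : Term C Γ .truth) : Term C Γ .truth :=
  eq fls A

/-- Conjunction as a closed term: `λ x, λ y, (λ g, g T T) = (λ g, g x y)`. -/
def conjOp : Term C Γ (.fn .truth (.fn .truth .truth)) :=
  lam (lam (eq
    (lam (α := .fn .truth (.fn .truth .truth)) (app (app (bound .here) tru) tru))
    (lam (α := .fn .truth (.fn .truth .truth))
      (app (app (bound .here) (bound (.there (.there .here)))) (bound (.there .here))))))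

def conj (A B : Term C Γ .truth) : Term C Γ .truth :=
  app (app conjOp A) B

/-- Disjunction as a closed term: `λ x, λ y, ¬ (¬ x ∧ ¬ y)`. -/
def disjOp : Term C Γ (.fn .truth (.fn .truth .truth)) :=
  lam (lam (neg (conj (neg (bound (.there .here))) (neg (bound .here)))))

def disj (A B : Term C Γ .truth) : Term C Γ .truth :=
  app (app disjOp A) B

/-- Implication as a closed term: `λ x, λ y, x = (x ∧ y)`. -/
def impOp : Term C Γ (.fn .truth (.fn .truth .truth)) :=
  lam (lam (eq (bound (.there .here)) (conj (bound (.there .here)) (bound .here))))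

def imp (A B : Term C Γ .truth) : Term C Γ .truth :=
  app (app impOp A) B

/-! ### Shortcuts for predicates and relations -/

/-- `(= B) := λ x, x = B`. -/
def eqTo {α : Ty n} (B : Term C Γ α) : Term C Γ (.fn α .truth) :=
  lam (eq (bound .here) (weaken B))

/-- `A × B := λ x, λ y, A x ∧ B y`, for predicates `A` and `B`. -/
def cross {α β : Ty n} (A : Term C Γ (.fn α .truth)) (B : Term C Γ (.fn β .truth)) :
    Term C Γ (.fn α (.fn β .truth)) :=
  lam (lam (conj (app (weaken (weaken A)) (bound (.there .here)))
    (app (weaken (weaken B)) (bound .here))))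

/-- `A ∨ B := λ x, A x ∨ B x`, for predicates `A` and `B`. -/
def predOr {α : Ty n} (A B : Term C Γ (.fn α .truth)) : Term C Γ (.fn α .truth) :=
  lam (disj (app (weaken A) (bound .here)) (app (weaken B) (bound .here)))

/-- `A ∨ B := λ x, A x ∨ B x`, for binary relations, where `A x` and `B x` are predicates. -/
def relOr {α β : Ty n} (A B : Term C Γ (.fn α (.fn β .truth))) :
    Term C Γ (.fn α (.fn β .truth)) :=
  lam (predOr (app (weaken A) (bound .here)) (app (weaken B) (bound .here)))

end Term

/-! ### The signature and the deductive system -/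

/-- The non-logical constants, for an alphabet of `N` letters: a constant of symbolic type for the
empty word and one for each letter, the concatenation constant, and arbitrary further constants
`κ α` of each type `α`. -/
inductive Const {n : ℕ} [NeZero n] (N : ℕ) (κ : Ty n → Type u) : Ty n → Type u
  | nil : Const N κ Ty.sym
  | letter : Fin N → Const N κ Ty.sym
  | cat : Const N κ (.fn Ty.sym (.fn Ty.sym Ty.sym))
  | other {α : Ty n} : κ α → Const N κ α

section

variable {n : ℕ} [NeZero n] {N : ℕ} {κ : Ty n → Type u}

/-- Terms over the signature `Const N κ`. -/
abbrev Tm (N : ℕ) (κ : Ty n → Type u) (Γ : List (Ty n)) (α : Ty n) : Type u :=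
  Term (Const N κ) Γ α

variable {Γ : List (Ty n)}

def nilT : Tm N κ Γ Ty.sym := .const .nil

def letterT (a : Fin N) : Tm N κ Γ Ty.sym := .const (.letter a)

def catT (A B : Tm N κ Γ Ty.sym) : Tm N κ Γ Ty.sym := .app (.app (.const .cat) A) B

/-- `Repl A B D E`: the term `E` arises from `D` by replacing one occurrence of `A` by `B`. The
occurrence may be inside binders of `D`, which may bind variables of `A` and `B`. -/
inductive Repl {Γ₀ : List (Ty n)} {α : Ty n} (A B : Tm N κ Γ₀ α) :
    ∀ {Γ : List (Ty n)} {β : Ty n}, Tm N κ Γ β → Tm N κ Γ β → Prop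
  | here : Repl A B A B
  | appL {Γ : List (Ty n)} {β γ : Ty n} {D E : Tm N κ Γ (.fn β γ)} (G : Tm N κ Γ β) :
      Repl A B D E → Repl A B (.app D G) (.app E G)
  | appR {Γ : List (Ty n)} {β γ : Ty n} (G : Tm N κ Γ (.fn β γ)) {D E : Tm N κ Γ β} :
      Repl A B D E → Repl A B (.app G D) (.app G E)
  | lam {Γ : List (Ty n)} {β γ : Ty n} {D E : Tm N κ (β :: Γ) γ} :
      Repl A B D E → Repl A B (.lam D) (.lam E)
  | eqL {Γ : List (Ty n)} {β : Ty n} {D E : Tm N κ Γ β} (G : Tm N κ Γ β) :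
      Repl A B D E → Repl A B (.eq D G) (.eq E G)
  | eqR {Γ : List (Ty n)} {β : Ty n} (G : Tm N κ Γ β) {D E : Tm N κ Γ β} :
      Repl A B D E → Repl A B (.eq G D) (.eq G E)
  | pairL {Γ : List (Ty n)} {β γ : Ty n} {D E : Tm N κ Γ β} (G : Tm N κ Γ γ) :
      Repl A B D E → Repl A B (.pair D G) (.pair E G)
  | pairR {Γ : List (Ty n)} {β γ : Ty n} (G : Tm N κ Γ β) {D E : Tm N κ Γ γ} :
      Repl A B D E → Repl A B (.pair G D) (.pair G E)
  | fst {Γ : List (Ty n)} {β γ : Ty n} {D E : Tm N κ Γ (.prod β γ)} :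
      Repl A B D E → Repl A B (.fst D) (.fst E)
  | snd {Γ : List (Ty n)} {β γ : Ty n} {D E : Tm N κ Γ (.prod β γ)} :
      Repl A B D E → Repl A B (.snd D) (.snd E)

open Term in
/-- Provability: Andrews' system `Q₀` with sorts, products and descriptions at all types, and the
axioms of the symbolic type (unit, associativity, distinctness of letters). Axioms with free
variables are stated as schemata; `Prov (Γ := Γ) A` allows free variables from `Γ` in `A`. -/
inductive Prov : ∀ {Γ : List (Ty n)}, Tm N κ Γ .truth → Prop
  /-- The truth values are `T` and `F`: `(G T ∧ G F) = ∀ x, G x`. -/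
  | bool {Γ : List (Ty n)} (G : Tm N κ Γ (.fn .truth .truth)) :
      Prov (eq (conj (app G tru) (app G fls)) (all (app (weaken G) (bound .here))))
  /-- `A = B → H A = H B`. -/
  | leibniz {Γ : List (Ty n)} {α : Ty n} (A B : Tm N κ Γ α) (H : Tm N κ Γ (.fn α .truth)) :
      Prov (imp (eq A B) (eq (app H A) (app H B)))
  /-- Extensionality: `(F = G) = ∀ x, F x = G x`. -/
  | funext {Γ : List (Ty n)} {α β : Ty n} (F G : Tm N κ Γ (.fn α β)) :
      Prov (eq (eq F G)
        (all (eq (app (weaken F) (bound .here)) (app (weaken G) (bound .here)))))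
  /-- Conversion: `(λ x, A) B = A[B / x]`. -/
  | beta {Γ : List (Ty n)} {α β : Ty n} (A : Tm N κ (α :: Γ) β) (B : Tm N κ Γ α) :
      Prov (eq (app (lam A) B) (A.inst B))
  /-- Description: `ι (λ x, A = x) = A`. -/
  | descr {Γ : List (Ty n)} {α : Ty n} (A : Tm N κ Γ α) :
      Prov (eq (app (iota α) (lam (eq (weaken A) (bound .here)))) A)
  | fst_pair {Γ : List (Ty n)} {α β : Ty n} (A : Tm N κ Γ α) (B : Tm N κ Γ β) :
      Prov (eq (fst (pair A B)) A)
  | snd_pair {Γ : List (Ty n)} {α β : Ty n} (A : Tm N κ Γ α) (B : Tm N κ Γ β) :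
      Prov (eq (snd (pair A B)) B)
  | pair_eta {Γ : List (Ty n)} {α β : Ty n} (A : Tm N κ Γ (.prod α β)) :
      Prov (eq (pair (fst A) (snd A)) A)
  /-- `∀ x, (x + ε = x) ∧ (ε + x = x)`. -/
  | unit {Γ : List (Ty n)} :
      Prov (Γ := Γ) (all (conj (eq (catT (bound .here) nilT) (bound .here))
        (eq (catT nilT (bound .here)) (bound .here))))
  /-- `∀ x y z, (x + y) + z = x + (y + z)`. -/
  | assoc {Γ : List (Ty n)} :
      Prov (Γ := Γ) (all (all (all (eq
        (catT (catT (bound (.there (.there .here))) (bound (.there .here))) (bound .here))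
        (catT (bound (.there (.there .here))) (catT (bound (.there .here)) (bound .here)))))))
  /-- `∀ x y z, x + a + y ≠ x + b + z`, for distinct letters `a` and `b`. -/
  | letters {Γ : List (Ty n)} (a b : Fin N) (hab : a < b) :
      Prov (Γ := Γ) (all (all (all (neg (eq
        (catT (catT (bound (.there (.there .here))) (letterT a)) (bound (.there .here)))
        (catT (catT (bound (.there (.there .here))) (letterT b)) (bound .here)))))))
  /-- Rule R: from `A = B` and `D`, infer the result of replacing one occurrence of `A` in `D`
  by `B`. -/
  | ruleR {Γ₀ Γ : List (Ty n)} {α : Ty n} {A B : Tm N κ Γ₀ α} {D E : Tm N κ Γ .truth} :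
      Prov (eq A B) → Prov D → Repl A B D E → Prov E

/-! ### Languages -/

/-- The term `T_A(w)` that denotes the word `w`. -/
def wordT : List (Fin N) → Tm N κ Γ Ty.sym
  | [] => nilT
  | [a] => letterT a
  | a :: b :: w => catT (letterT a) (wordT (b :: w))

/-- An `α`-language: a set of pairs of a word and a term of type `α`, open terms included. -/
abbrev Lang (N : ℕ) (κ : Ty n → Type u) (α : Ty n) : Type u :=
  Set (List (Fin N) × Tm N κ [] α)

variable {α : Ty n}

def LogicallyClosed (L : Lang N κ α) : Prop :=
  ∀ (w : List (Fin N)) (A B D : Tm N κ [] α), (w, B) ∈ L → (w, D) ∈ L →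
    Prov (Term.disj (.eq A B) (.eq A D)) → (w, A) ∈ L

/-- `K` is the logical closure of `L`: the least logically closed language that includes `L`. -/
def IsLogicalClosure (K L : Lang N κ α) : Prop :=
  IsLeast {M : Lang N κ α | LogicallyClosed M ∧ L ⊆ M} K

/-- A lexicon: the logical closure of a finite language. -/
def IsLexicon (K : Lang N κ α) : Prop :=
  ∃ L : Lang N κ α, L.Finite ∧ IsLogicalClosure K L

/-- The term `(= T_A(w₁)) × (= A₁) ∨ … ∨ (= T_A(wₗ)) × (= Aₗ)`; for `l = 0` it is
`λ x, λ y, F`. -/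
def canonicTerm : List (List (Fin N) × Tm N κ [] α) → Tm N κ [] (.fn Ty.sym (.fn α .truth))
  | [] => .lam (.lam Term.fls)
  | [p] => Term.cross (Term.eqTo (wordT p.1)) (Term.eqTo p.2)
  | p :: q :: G => Term.relOr (Term.cross (Term.eqTo (wordT p.1)) (Term.eqTo p.2))
      (canonicTerm (q :: G))

/-! ### Extensions by further constants, and representations -/

/-- The family of further constants `κ`, extended by the new constants `ξ`. -/
abbrev extend (κ : Ty n → Type u) (ξ : Ty n → Type v) : Ty n → Type (max u v) :=
  fun α => κ α ⊕ ξ α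

def Const.toExt (ξ : Ty n → Type v) : ∀ α : Ty n, Const N κ α → Const N (extend κ ξ) α
  | _, .nil => .nil
  | _, .letter a => .letter a
  | _, .cat => .cat
  | _, .other c => .other (.inl c)

/-- A term, regarded as a term over the signature extended by the constants `ξ`. -/
def toExt (ξ : Ty n → Type v) (A : Tm N κ Γ α) : Tm N (extend κ ξ) Γ α :=
  A.mapConst (Const.toExt ξ)

/-- The language `L` is represented by the term `R` of the extension by the constants `ξ`. -/
def Represents (ξ : Ty n → Type v) (R : Tm N (extend κ ξ) [] (.fn Ty.sym (.fn α .truth)))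
    (L : Lang N κ α) : Prop :=
  ∀ (w : List (Fin N)) (A : Tm N κ [] α),
    (w, A) ∈ L ↔ Prov (.app (.app R (wordT w)) (toExt ξ A))

/-- The term `canonicTerm G`, formed in the extension by the constants `ξ`. -/
def canonicTermExt (ξ : Ty n → Type v) (G : List (List (Fin N) × Tm N κ [] α)) :
    Tm N (extend κ ξ) [] (.fn Ty.sym (.fn α .truth)) :=
  canonicTerm (G.map fun p => (p.1, toExt ξ p.2))

/-- `L` has a canonic representation, by a term of the extension by the constants `ξ`. -/
def HasCanonicRep (ξ : Ty n → Type v) (L : Lang N κ α) : Prop :=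
  ∃ R : Tm N (extend κ ξ) [] (.fn Ty.sym (.fn α .truth)), Represents ξ R L ∧
    ∃ G : List (List (Fin N) × Tm N κ [] α), Prov (.eq R (canonicTermExt ξ G))

end

end TyN

/-! For a finite list `G`, let M(G) be the set of pairs (w, A) for which the canonic term of `G`
provably holds of T_A(w) and A. Everything follows from the fact that M(G) is the logical closure of
`G` (`isLogicalClosure_canonicTerm`). That M(G) includes `G` is propositional logic, and it is
logically closed by Leibniz's law.

For leastness, let (w, A) be in M(G). Distinct words are provably unequal (`wordT_ne`), so the
entries of `G` for other words drop out, which leaves a provable disjunction A = B₁ ∨ … ∨ A = Bₖ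
over the entries (w, Bᵢ) of `G`. The case k = 0 is excluded by consistency, shown by a standard
model over the free monoid (`not_prov_fls`). Logical closedness concerns only two disjuncts. To
reach larger k, the description operator supplies a term D that is A if A = B₂ ∨ … ∨ A = Bₖ, and B₂
otherwise (`exists_ite`). Then D = B₂ ∨ … ∨ D = Bₖ is provable, so (w, D) is in the language by
induction, and A = B₁ ∨ A = D is provable (`LogicallyClosed.mem_of_eqAny`).

New constants do no harm: they satisfy no axioms of their own, so closed terms may replace them
throughout a proof (`prov_toExt_iff`).

Propositional reasoning inside the calculus is automated by `taut`, which is derived from the axioms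
through the truth tables of the defined connectives. -/

namespace TyN

namespace Term

variable {n : ℕ} {C : Ty n → Type u}

/-! ### Substitution calculus -/

theorem liftSub_comp_liftRen {Γ Δ Θ : List (Ty n)} {γ : Ty n} (ρ : ∀ α, BVar Γ α → BVar Δ α)
    (σ : ∀ α, BVar Δ α → Term C Θ α) :
    (fun α x => liftSub (γ := γ) σ α (liftRen ρ α x)) = liftSub fun α x => σ α (ρ α x) := by
  funext α x
  cases x <;> rfl

theorem subst_rename {Γ Δ Θ : List (Ty n)} {α : Ty n} (ρ : ∀ α, BVar Γ α → BVar Δ α)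
    (σ : ∀ α, BVar Δ α → Term C Θ α) (A : Term C Γ α) :
    subst σ (rename ρ A) = subst (fun α x => σ α (ρ α x)) A := by
  induction A generalizing Δ Θ with
  | lam A ih => simp only [rename, subst, ih, liftSub_comp_liftRen]
  | _ => simp_all [rename, subst]

theorem liftSub_bound {Γ : List (Ty n)} {γ : Ty n} :
    liftSub (C := C) (γ := γ) (fun α (x : BVar Γ α) => bound x) = fun _ x => bound x := by
  funext α x
  cases x <;> rfl

theorem subst_bound {Γ : List (Ty n)} {α : Ty n} (A : Term C Γ α) :
    subst (fun _ x => bound x) A = A := by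
  induction A with
  | lam A ih => simp only [subst, liftSub_bound, ih]
  | _ => simp_all [subst]

@[simp]
theorem inst_weaken {Γ : List (Ty n)} {α γ : Ty n} (A : Term C Γ α) (B : Term C Γ γ) :
    (weaken A).inst B = A := by
  simp only [inst, weaken, subst_rename]
  exact subst_bound A

theorem subst_instSub_weaken {Γ : List (Ty n)} {α γ : Ty n} (A : Term C Γ α) (B : Term C Γ γ) :
    subst (instSub B) (weaken A) = A :=
  inst_weaken A B

theorem rename_eq_subst {Γ Δ : List (Ty n)} {α : Ty n} (ρ : ∀ α, BVar Γ α → BVar Δ α)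
    (A : Term C Γ α) : rename ρ A = subst (fun α x => bound (ρ α x)) A := by
  rw [← subst_bound (rename ρ A), subst_rename]

/-- Substitution for the second innermost variable in a term that uses neither of the two. -/
theorem subst_liftSub_weaken_weaken {Γ : List (Ty n)} {α γ δ : Ty n} (A : Term C Γ α)
    (B : Term C Γ γ) :
    subst (liftSub (γ := δ) (instSub B)) (weaken (weaken A)) = weaken A := by
  simp only [weaken, subst_rename]
  rw [rename_eq_subst]
  rfl

@[simp] theorem subst_tru {Γ Δ : List (Ty n)} (σ : ∀ α, BVar Γ α → Term C Δ α) :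
    subst σ tru = tru := rfl

@[simp] theorem subst_fls {Γ Δ : List (Ty n)} (σ : ∀ α, BVar Γ α → Term C Δ α) :
    subst σ fls = fls := rfl

@[simp] theorem subst_neg {Γ Δ : List (Ty n)} (σ : ∀ α, BVar Γ α → Term C Δ α)
    (A : Term C Γ .truth) : subst σ (neg A) = neg (subst σ A) := rfl

@[simp] theorem subst_conj {Γ Δ : List (Ty n)} (σ : ∀ α, BVar Γ α → Term C Δ α)
    (A B : Term C Γ .truth) : subst σ (conj A B) = conj (subst σ A) (subst σ B) := rfl

@[simp] theorem subst_disj {Γ Δ : List (Ty n)} (σ : ∀ α, BVar Γ α → Term C Δ α)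
    (A B : Term C Γ .truth) : subst σ (disj A B) = disj (subst σ A) (subst σ B) := rfl

@[simp] theorem subst_imp {Γ Δ : List (Ty n)} (σ : ∀ α, BVar Γ α → Term C Δ α)
    (A B : Term C Γ .truth) : subst σ (imp A B) = imp (subst σ A) (subst σ B) := rfl

end Term

/-! ### Elementary derivations -/

namespace Prov

open Term

variable {n : ℕ} [NeZero n] {N : ℕ} {κ : Ty n → Type u} {Γ : List (Ty n)} {α β γ : Ty n}

/-- A vacuous abstraction gives (λ x, A) A = A; rewriting the left side of this equation by the
equation itself yields A = A. -/
theorem refl (A : Tm N κ Γ α) : Prov (eq A A) := by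
  have h := beta (weaken (γ := α) A) A
  rw [inst_weaken] at h
  exact ruleR h h (.eqL _ .here)

theorem symm {A B : Tm N κ Γ α} (h : Prov (eq A B)) : Prov (eq B A) :=
  ruleR h (refl A) (.eqL _ .here)

theorem trans {A B D : Tm N κ Γ α} (h : Prov (eq A B)) (h' : Prov (eq B D)) : Prov (eq A D) :=
  ruleR h' h (.eqR _ .here)

theorem eq_mp {A B : Tm N κ Γ .truth} (h : Prov (eq A B)) (hA : Prov A) : Prov B :=
  ruleR h hA .here

theorem eq_mpr {A B : Tm N κ Γ .truth} (h : Prov (eq A B)) (hB : Prov B) : Prov A :=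
  eq_mp h.symm hB

theorem congr_app {A A' : Tm N κ Γ (.fn α β)} {B B' : Tm N κ Γ α} (h : Prov (eq A A'))
    (h' : Prov (eq B B')) : Prov (eq (app A B) (app A' B')) :=
  ruleR h' (ruleR h (refl _) (.eqR _ (.appL _ .here))) (.eqR _ (.appR _ .here))

theorem congr_eq {A A' B B' : Tm N κ Γ α} (h : Prov (eq A A')) (h' : Prov (eq B B')) :
    Prov (eq (eq A B) (eq A' B')) :=
  ruleR h' (ruleR h (refl _) (.eqR _ (.eqL _ .here))) (.eqR _ (.eqR _ .here))

theorem congr_lam {A A' : Tm N κ (α :: Γ) β} (h : Prov (eq A A')) :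
    Prov (eq (lam A) (lam A')) :=
  ruleR h (refl _) (.eqR _ (.lam .here))

theorem congr_all {A A' : Tm N κ (α :: Γ) .truth} (h : Prov (eq A A')) :
    Prov (eq (all A) (all A')) :=
  congr_eq (refl _) (congr_lam h)

theorem congr_conj {A A' B B' : Tm N κ Γ .truth} (h : Prov (eq A A')) (h' : Prov (eq B B')) :
    Prov (eq (conj A B) (conj A' B')) :=
  congr_app (congr_app (refl _) h) h'

theorem congr_disj {A A' B B' : Tm N κ Γ .truth} (h : Prov (eq A A')) (h' : Prov (eq B B')) :
    Prov (eq (disj A B) (disj A' B')) :=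
  congr_app (congr_app (refl _) h) h'

theorem congr_imp {A A' B B' : Tm N κ Γ .truth} (h : Prov (eq A A')) (h' : Prov (eq B B')) :
    Prov (eq (imp A B) (imp A' B')) :=
  congr_app (congr_app (refl _) h) h'

theorem congr_neg {A A' : Tm N κ Γ .truth} (h : Prov (eq A A')) :
    Prov (eq (neg A) (neg A')) :=
  congr_eq (refl _) h

theorem congr_cat {A A' B B' : Tm N κ Γ Ty.sym} (h : Prov (eq A A')) (h' : Prov (eq B B')) :
    Prov (eq (catT A B) (catT A' B')) :=
  congr_app (congr_app (refl _) h) h'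

theorem beta_congr {A : Tm N κ (α :: Γ) β} {B : Tm N κ Γ α} {D : Tm N κ Γ β}
    (h : A.inst B = D) : Prov (eq (app (lam A) B) D) :=
  h ▸ beta A B

theorem beta_beta (A : Tm N κ (β :: α :: Γ) γ) (B : Tm N κ Γ α) (D : Tm N κ Γ β) :
    Prov (eq (app (app (lam (lam A)) B) D) ((subst (liftSub (instSub B)) A).inst D)) :=
  (congr_app (beta (lam A) B) (refl D)).trans (beta _ D)

/-- Every reflexive equation equals `T`. -/
theorem tru_eq_refl (B : Tm N κ Γ α) : Prov (eq tru (eq B B)) := by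
  have h1 := funext (lam (α := α) (bound .here) : Tm N κ Γ _) (lam (bound .here))
  -- Extensionality for the identity function turns the reflexive equation id = id into ∀ x, x = x.
  have h2 : Prov (all (eq (bound .here) (bound .here)) : Tm N κ Γ .truth) :=
    have hb : Prov (eq (app (weaken (lam (α := α) (bound .here) : Tm N κ Γ _)) (bound .here))
        (bound .here)) := beta _ _
    eq_mp (h1.trans (congr_all (congr_eq hb hb))) (refl _)
  -- A universal statement is an equation λ x, T = λ x, …, so both sides can be applied to `B`.
  have h3 := congr_app h2 (refl B)
  exact (beta_congr (A := tru) (B := B) rfl).symm.trans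
    (h3.trans (beta_congr (A := eq (bound .here) (bound .here)) rfl))

theorem tru_intro : Prov (tru : Tm N κ Γ .truth) := refl _

theorem bool_inst (Q : Tm N κ (.truth :: Γ) .truth) :
    Prov (eq (conj (Q.inst tru) (Q.inst fls)) (all Q)) := by
  refine (congr_conj (beta Q _) (beta Q _)).symm.trans ((bool (lam Q)).trans (congr_all ?_))
  refine beta_congr ?_
  simp only [inst, subst_rename]
  refine Eq.trans ?_ (subst_bound Q)
  congr 1
  funext α x
  cases x <;> rfl

/-- The first two entries of the table for ∧ come from `bool_inst`: ∀ x, T is a reflexive equation,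
and ∀ x, x is F by definition. -/
theorem conj_tru_tru : Prov (eq (conj tru tru) (tru : Tm N κ Γ .truth)) :=
  (bool_inst (tru : Tm N κ (.truth :: Γ) .truth)).trans (tru_eq_refl _).symm

theorem conj_tru_fls : Prov (eq (conj tru fls) (fls : Tm N κ Γ .truth)) :=
  bool_inst (bound .here)

/-- Universal instantiation. -/
theorem all_elim {A : Tm N κ (α :: Γ) .truth} (h : Prov (all A)) (B : Tm N κ Γ α) :
    Prov (A.inst B) :=
  eq_mp ((beta_congr (A := tru) (B := B) rfl).symm.trans
    ((congr_app h (refl B)).trans (beta A B))) tru_intro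

/-- Case distinction over truth values, for equations. -/
theorem bool_cases_eq {A B : Tm N κ (.truth :: Γ) α}
    (hT : Prov (eq (A.inst tru) (B.inst tru))) (hF : Prov (eq (A.inst fls) (B.inst fls)))
    (P : Tm N κ Γ .truth) : Prov (eq (A.inst P) (B.inst P)) := by
  -- That a provable formula equals T is not yet available in general. For an equation it follows by
  -- rewriting one side of a reflexive equation, which is why this case distinction is stated for
  -- equations.
  have t1 : Prov (eq tru (eq (A.inst tru) (B.inst tru))) :=
    (tru_eq_refl _).trans (congr_eq (refl _) hT)
  have t2 : Prov (eq tru (eq (A.inst fls) (B.inst fls))) :=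
    (tru_eq_refl _).trans (congr_eq (refl _) hF)
  have h : Prov (all (eq A B)) :=
    eq_mp ((congr_conj t1 t2).trans (bool_inst (eq A B))) (eq_mpr conj_tru_tru tru_intro)
  exact all_elim h P

theorem tru_conj (A : Tm N κ Γ .truth) : Prov (eq (conj tru A) A) :=
  bool_cases_eq (A := (conj tru (bound .here) : Tm N κ (.truth :: Γ) _)) (B := bound .here)
    conj_tru_tru conj_tru_fls A

/-- F is literally the equation λ x, T = λ x, x, which extensionality identifies with ∀ x, T = x. By
the two-valuedness axiom this is (T = T) ∧ (T = F), that is, T = F. -/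
theorem tru_eq_fls : Prov (eq (eq tru fls) (fls : Tm N κ Γ .truth)) := by
  have h1 := funext (lam tru : Tm N κ Γ (.fn .truth .truth)) (lam (bound .here))
  have h2 : Prov (eq fls (all (eq tru (bound .here)) : Tm N κ Γ .truth)) :=
    h1.trans (congr_all (congr_eq (beta_congr rfl) (beta_congr rfl)))
  have h3 : Prov (eq (conj (eq tru tru) (eq tru fls))
      (all (eq tru (bound .here)) : Tm N κ Γ .truth)) :=
    bool_inst (eq tru (bound .here))
  exact (tru_conj _).symm.trans ((congr_conj (tru_eq_refl _) (refl _)).trans (h3.trans h2.symm))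

theorem tru_eq (A : Tm N κ Γ .truth) : Prov (eq (eq tru A) A) :=
  bool_cases_eq (A := (eq tru (bound .here) : Tm N κ (.truth :: Γ) _)) (B := bound .here)
    (tru_eq_refl _).symm tru_eq_fls A

theorem eq_tru {A : Tm N κ Γ .truth} (h : Prov A) : Prov (eq A tru) :=
  (eq_mpr (tru_eq A) h).symm

theorem of_eq_tru {A : Tm N κ Γ .truth} (h : Prov (eq A tru)) : Prov A :=
  eq_mpr h tru_intro

/-- Case distinction over truth values. -/
theorem bool_cases {Q : Tm N κ (.truth :: Γ) .truth} (hT : Prov (Q.inst tru))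
    (hF : Prov (Q.inst fls)) (P : Tm N κ Γ .truth) : Prov (Q.inst P) :=
  of_eq_tru (bool_cases_eq (B := tru) (eq_tru hT) (eq_tru hF) P)

theorem imp_unfold (A B : Tm N κ Γ .truth) : Prov (eq (imp A B) (eq A (conj A B))) := by
  have h := beta_beta (eq (bound (.there .here)) (conj (bound (.there .here)) (bound .here))) A B
  simp only [inst, subst, subst_conj, liftSub, instSub, subst_instSub_weaken] at h
  exact h

theorem disj_unfold (A B : Tm N κ Γ .truth) :
    Prov (eq (disj A B) (neg (conj (neg A) (neg B)))) := by
  have h := beta_beta (neg (conj (neg (bound (.there .here))) (neg (bound .here)))) A B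
  simp only [inst, subst, subst_conj, subst_neg, liftSub, instSub, subst_instSub_weaken] at h
  exact h

theorem tru_imp (A : Tm N κ Γ .truth) : Prov (eq (imp tru A) A) :=
  (imp_unfold _ _).trans ((congr_eq (refl _) (tru_conj A)).trans (tru_eq A))

/-- Modus ponens. -/
theorem mp {A B : Tm N κ Γ .truth} (h : Prov (imp A B)) (hA : Prov A) : Prov B :=
  eq_mp ((congr_imp (eq_tru hA) (refl B)).trans (tru_imp B)) h

theorem fls_imp (A : Tm N κ Γ .truth) : Prov (imp fls A) := by
  -- The hypothesis of this instance is F itself. Evaluation at `A` sends the two functions to T and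
  -- `A`, so the conclusion is T = A.
  have h := leibniz (lam tru : Tm N κ Γ (.fn .truth .truth)) (lam (bound .here))
    (lam (app (bound .here) (weaken A)))
  refine eq_mp (congr_imp (refl _) ((congr_eq ?_ ?_).trans (tru_eq A))) h
  · refine (beta _ _).trans (beta_congr rfl)
  · refine (beta _ _).trans (beta_congr ?_)
    exact inst_weaken _ _

theorem fls_conj (A : Tm N κ Γ .truth) : Prov (eq (conj fls A) fls) :=
  (eq_mp (imp_unfold _ _) (fls_imp A)).symm

theorem conj_fls (A : Tm N κ Γ .truth) : Prov (eq (conj A fls) fls) :=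
  bool_cases_eq (A := (conj (bound .here) fls : Tm N κ (.truth :: Γ) _)) (B := fls)
    conj_tru_fls (fls_conj _) A

theorem fls_eq_tru : Prov (eq (eq fls tru) (fls : Tm N κ Γ .truth)) := by
  -- The predicate λ x, x = F turns F = T into (F = F) = (T = F), which already reduces to F.
  have h := leibniz (fls : Tm N κ Γ .truth) tru (lam (eq (bound .here) fls))
  have h' : Prov (imp (eq fls tru) (fls : Tm N κ Γ .truth)) := by
    refine eq_mp (congr_imp (refl _) ?_) h
    refine (congr_eq (beta_congr (D := eq fls fls) rfl) (beta_congr (D := eq tru fls) rfl)).trans ?_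
    exact (congr_eq (tru_eq_refl fls).symm tru_eq_fls).trans tru_eq_fls
  exact (eq_mp (imp_unfold _ _) h').trans (conj_fls _)

end Prov

end TyN

namespace TyN

/-! ### Propositional tautologies -/

/-- Propositional formulas in `m` variables. -/
inductive PropForm (m : ℕ) : Type
  | var : Fin m → PropForm m
  | fls : PropForm m
  | neg : PropForm m → PropForm m
  | conj : PropForm m → PropForm m → PropForm m
  | disj : PropForm m → PropForm m → PropForm m
  | imp : PropForm m → PropForm m → PropForm m
  | iff : PropForm m → PropForm m → PropForm m

namespace PropForm

variable {m : ℕ}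

def eval (b : Fin m → Bool) : PropForm m → Bool
  | var i => b i
  | fls => false
  | neg p => !p.eval b
  | conj p q => p.eval b && q.eval b
  | disj p q => p.eval b || q.eval b
  | imp p q => !p.eval b || q.eval b
  | iff p q => p.eval b == q.eval b

variable {n : ℕ} {C : Ty n → Type u} {Γ Δ : List (Ty n)}

/-- The term obtained from a propositional formula by putting terms for its variables. -/
def interp (v : Fin m → Term C Γ .truth) : PropForm m → Term C Γ .truth
  | var i => v i
  | fls => .fls
  | neg p => .neg (p.interp v)
  | conj p q => .conj (p.interp v) (q.interp v)
  | disj p q => .disj (p.interp v) (q.interp v)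
  | imp p q => .imp (p.interp v) (q.interp v)
  | iff p q => .eq (p.interp v) (q.interp v)

theorem subst_interp (σ : ∀ α, BVar Γ α → Term C Δ α) (v : Fin m → Term C Γ .truth)
    (p : PropForm m) : (p.interp v).subst σ = p.interp fun i => (v i).subst σ := by
  induction p with
  | var i => rfl
  | fls => rfl
  | neg p ih => simp only [interp, Term.subst_neg, ih]
  | conj p q ihp ihq => simp only [interp, Term.subst_conj, ihp, ihq]
  | disj p q ihp ihq => simp only [interp, Term.subst_disj, ihp, ihq]
  | imp p q ihp ihq => simp only [interp, Term.subst_imp, ihp, ihq]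
  | iff p q ihp ihq => simp only [interp, Term.subst, ihp, ihq]

end PropForm

namespace Prov

open Term

/-- The term for a truth value. -/
def ofBool {n : ℕ} {C : Ty n → Type u} {Γ : List (Ty n)} (b : Bool) : Term C Γ .truth :=
  if b then tru else fls

variable {n : ℕ} [NeZero n] {N : ℕ} {κ : Ty n → Type u} {Γ : List (Ty n)} {α β γ : Ty n}

theorem ofBool_eq (a b : Bool) :
    Prov (eq (eq (ofBool a) (ofBool b)) (ofBool (a == b) : Tm N κ Γ .truth)) := by
  cases a <;> cases b
  exacts [(tru_eq_refl _).symm, fls_eq_tru, tru_eq_fls, (tru_eq_refl _).symm]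

theorem ofBool_neg (a : Bool) : Prov (eq (neg (ofBool a)) (ofBool (!a) : Tm N κ Γ .truth)) := by
  have h := ofBool_eq (κ := κ) (N := N) (Γ := Γ) false a
  cases a <;> exact h

theorem ofBool_conj (a b : Bool) :
    Prov (eq (conj (ofBool a) (ofBool b)) (ofBool (a && b) : Tm N κ Γ .truth)) := by
  cases a
  · exact fls_conj _
  · exact tru_conj _

theorem ofBool_disj (a b : Bool) :
    Prov (eq (disj (ofBool a) (ofBool b)) (ofBool (a || b) : Tm N κ Γ .truth)) := by
  have h := (disj_unfold (ofBool a) (ofBool b : Tm N κ Γ .truth)).trans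
    ((congr_neg ((congr_conj (ofBool_neg a) (ofBool_neg b)).trans (ofBool_conj _ _))).trans
      (ofBool_neg _))
  simpa using h

theorem ofBool_imp (a b : Bool) :
    Prov (eq (imp (ofBool a) (ofBool b)) (ofBool (!a || b) : Tm N κ Γ .truth)) := by
  have h := (imp_unfold (ofBool a) (ofBool b : Tm N κ Γ .truth)).trans
    ((congr_eq (refl _) (ofBool_conj a b)).trans (ofBool_eq _ _))
  cases a <;> cases b <;> exact h

theorem interp_ofBool {m : ℕ} (b : Fin m → Bool) (p : PropForm m) :
    Prov (eq (p.interp fun i => ofBool (b i)) (ofBool (p.eval b) : Tm N κ Γ .truth)) := by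
  induction p with
  | var i => exact refl _
  | fls => exact refl _
  | neg p ih => exact (congr_neg ih).trans (ofBool_neg _)
  | conj p q ihp ihq => exact (congr_conj ihp ihq).trans (ofBool_conj _ _)
  | disj p q ihp ihq => exact (congr_disj ihp ihq).trans (ofBool_disj _ _)
  | imp p q ihp ihq => exact (congr_imp ihp ihq).trans (ofBool_imp _ _)
  | iff p q ihp ihq => exact (congr_eq ihp ihq).trans (ofBool_eq _ _)

/-- Substitution instances of tautologies are provable. -/
theorem taut {m : ℕ} (p : PropForm m) (v : Fin m → Tm N κ Γ .truth)
    (h : ∀ b, p.eval b = true) : Prov (p.interp v) := by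
  -- `s` holds the variables not yet replaced by truth values. Each induction step settles one of
  -- them by `bool_cases`; once `s` is empty, the formula is evaluated by truth tables.
  suffices H : ∀ (s : Finset (Fin m)) (b : Fin m → Bool) (v : Fin m → Tm N κ Γ .truth),
      (∀ i ∉ s, v i = ofBool (b i)) → Prov (p.interp v) from
    H Finset.univ (fun _ => true) v fun i hi => absurd (Finset.mem_univ i) hi
  intro s
  induction s using Finset.induction_on with
  | empty =>
    intro b v hv
    obtain rfl : v = fun i => ofBool (b i) := _root_.funext fun i => hv i (by simp)
    have hp := interp_ofBool (N := N) (κ := κ) (Γ := Γ) b p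
    rw [h b] at hp
    exact of_eq_tru hp
  | insert k s hk ih =>
    intro b v hv
    -- The term for variable `k` is abstracted to a bound variable, so that a case distinction on it
    -- becomes possible.
    have key : ∀ P : Tm N κ Γ .truth,
        (p.interp (Function.update (fun i => weaken (v i)) k (bound .here))).inst P =
          p.interp (Function.update v k P) := by
      intro P
      rw [inst, PropForm.subst_interp]
      congr 1
      funext i
      by_cases hi : i = k
      · subst hi
        simp [subst, instSub]
      · simp [hi, subst_instSub_weaken]
    have hb : ∀ c : Bool, Prov (p.interp (Function.update v k (ofBool c))) := by
      intro c
      refine ih (Function.update b k c) _ fun i hi => ?_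
      by_cases hik : i = k
      · subst hik
        simp
      · simp [hik, hv i (by simp [hik, hi])]
    have := bool_cases (Q := p.interp (Function.update (fun i => weaken (v i)) k (bound .here)))
      (by rw [key]; exact hb true) (by rw [key]; exact hb false) (v k)
    rw [key, Function.update_eq_self] at this
    exact this

/-! ### Consequences of Leibniz's law, and definition by cases -/

theorem contrapose {A B : Tm N κ Γ .truth} (h : Prov (imp A B)) (hB : Prov (neg B)) :
    Prov (neg A) :=
  ((taut (.imp (.imp (.var 0) (.var 1)) (.imp (.neg (.var 1)) (.neg (.var 0)))) ![A, B]
    (by decide)).mp h).mp hB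

/-- A false equation remains false after the sides are exchanged. -/
theorem ne_symm {A B : Tm N κ Γ α} (h : Prov (neg (eq A B))) : Prov (neg (eq B A)) := by
  have h1 := leibniz B A (lam (eq (weaken A) (bound .here)))
  have h2 : Prov (imp (eq B A) (eq (eq A B) (eq A A))) := by
    refine eq_mp (congr_imp (refl _) (congr_eq (beta_congr ?_) (beta_congr ?_))) h1 <;>
    · simp only [inst, subst, subst_instSub_weaken]
      rfl
  exact (((taut (.imp (.imp (.var 0) (.iff (.var 1) (.var 2)))
    (.imp (.var 2) (.imp (.neg (.var 1)) (.neg (.var 0))))) ![eq B A, eq A B, eq A A]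
    (by decide)).mp h2).mp (refl A)).mp h

/-- Equal arguments give equal values. -/
theorem eq_imp_app (F : Tm N κ Γ (.fn α β)) (A B : Tm N κ Γ α) :
    Prov (imp (eq A B) (eq (app F A) (app F B))) := by
  have h1 := leibniz A B (lam (eq (weaken (app F A)) (app (weaken F) (bound .here))))
  have h2 : Prov (imp (eq A B) (eq (eq (app F A) (app F A)) (eq (app F A) (app F B)))) := by
    refine eq_mp (congr_imp (refl _) (congr_eq (beta_congr ?_) (beta_congr ?_))) h1 <;>
    · simp only [inst, subst, subst_instSub_weaken]
      rfl
  exact ((taut (.imp (.imp (.var 0) (.iff (.var 1) (.var 2))) (.imp (.var 1)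
    (.imp (.var 0) (.var 2)))) ![eq A B, eq (app F A) (app F A), eq (app F A) (app F B)]
    (by decide)).mp h2).mp (refl _)

theorem eqTo_app (A B : Tm N κ Γ α) : Prov (eq (app (eqTo B) A) (eq A B)) :=
  beta_congr (by simp only [inst, subst, subst_instSub_weaken]; rfl)

theorem eq_imp_eq (A A' B : Tm N κ Γ α) :
    Prov (imp (eq A A') (eq (eq A B) (eq A' B))) :=
  eq_mp (congr_imp (refl _) (congr_eq (eqTo_app A B) (eqTo_app A' B))) (leibniz A A' (eqTo B))

/-- Definition by cases, by means of the description operator. -/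
theorem exists_ite (P : Tm N κ Γ .truth) (A B : Tm N κ Γ α) :
    ∃ D : Tm N κ Γ α, Prov (imp P (eq A D)) ∧ Prov (imp (neg P) (eq D B)) := by
  -- The description "the y with (p ∧ A = y) ∨ (¬p ∧ B = y)", in a truth variable p. For p = T or p
  -- = F its predicate reduces to A = y or B = y, to which the description axiom applies.
  let E : Tm N κ (.truth :: Γ) α :=
    app (iota α) (lam (disj (conj (bound (.there .here)) (eq (weaken (weaken A)) (bound .here)))
      (conj (neg (bound (.there .here))) (eq (weaken (weaken B)) (bound .here)))))
  have hE : ∀ P : Tm N κ Γ .truth, E.inst P = app (iota α) (lam (disj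
      (conj (weaken P) (eq (weaken A) (bound .here)))
      (conj (neg (weaken P)) (eq (weaken B) (bound .here))))) := by
    intro P
    simp only [E, inst, subst, subst_disj, subst_conj, subst_neg, subst_liftSub_weaken_weaken]
    rfl
  have hT : Prov (eq (E.inst tru) A) := by
    rw [hE]
    refine (congr_app (refl _) (congr_lam ?_)).trans (descr A)
    exact (taut (.imp (.var 0) (.iff (.disj (.conj (.var 0) (.var 1)) (.conj (.neg (.var 0))
      (.var 2))) (.var 1))) ![weaken tru, _, _] (by decide)).mp tru_intro
  have hF : Prov (eq (E.inst fls) B) := by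
    rw [hE]
    refine (congr_app (refl _) (congr_lam ?_)).trans (descr B)
    exact taut (.iff (.disj (.conj .fls (.var 0)) (.conj (.neg .fls)
      (.var 1))) (.var 1)) ![_, _] (by decide)
  have beta' : ∀ P, Prov (eq (app (lam E) P) (E.inst P)) := fun P => beta E P
  have hQ : ∀ P : Tm N κ Γ .truth,
      (imp (bound .here) (eq (weaken A) (app (weaken (lam E)) (bound .here)))).inst P =
        imp P (eq A (app (lam E) P)) ∧
      (imp (neg (bound .here)) (eq (app (weaken (lam E)) (bound .here)) (weaken B))).inst P =
        imp (neg P) (eq (app (lam E) P) B) := by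
    intro P
    constructor <;>
    · simp only [inst, subst, subst_imp, subst_neg, subst_instSub_weaken]
      rfl
  -- Leaving the redex unreduced makes `P` a mere argument of a fixed function, so both claims are
  -- instances of formulas in one truth variable.
  refine ⟨app (lam E) P, ?_, ?_⟩
  · rw [← (hQ P).1]
    refine bool_cases ?_ ?_ P
    · rw [(hQ _).1]
      exact (taut (.imp (.var 1) (.imp (.var 0) (.var 1))) ![tru, _] (by decide)).mp
        ((beta' _).trans hT).symm
    · rw [(hQ _).1]
      exact fls_imp _
  · rw [← (hQ P).2]
    refine bool_cases ?_ ?_ P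
    · rw [(hQ _).2]
      exact (taut (.imp (.var 0) (.imp (.neg (.var 0)) (.var 1))) ![tru, _] (by decide)).mp
        tru_intro
    · rw [(hQ _).2]
      exact (taut (.imp (.var 1) (.imp (.neg (.var 0)) (.var 1))) ![fls, _] (by decide)).mp
        ((beta' _).trans hF)

end Prov

end TyN

namespace TyN

/-! ### Provable inequality of distinct words -/

namespace Prov

open Term

variable {n : ℕ} [NeZero n] {N : ℕ} {κ : Ty n → Type u} {Γ : List (Ty n)} {α β γ : Ty n}

theorem cat_nil (A : Tm N κ Γ Ty.sym) : Prov (eq (catT A nilT) A) :=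
  (taut (.imp (.conj (.var 0) (.var 1)) (.var 0)) ![_, eq (catT nilT A) A] (by decide)).mp
    (all_elim unit A)

theorem nil_cat (A : Tm N κ Γ Ty.sym) : Prov (eq (catT nilT A) A) :=
  (taut (.imp (.conj (.var 0) (.var 1)) (.var 1)) ![eq (catT A nilT) A, _] (by decide)).mp
    (all_elim unit A)

theorem all_elim₃ {α β γ : Ty n} {A : Tm N κ (γ :: β :: α :: Γ) .truth}
    (h : Prov (all (all (all A)))) (X : Tm N κ Γ α) (Y : Tm N κ Γ β) (Z : Tm N κ Γ γ) :
    Prov (((A.subst (liftSub (liftSub (instSub X)))).subst (liftSub (instSub Y))).inst Z) :=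
  all_elim (all_elim (all_elim h X) Y) Z

theorem cat_assoc (X Y Z : Tm N κ Γ Ty.sym) :
    Prov (eq (catT (catT X Y) Z) (catT X (catT Y Z))) := by
  have h := all_elim₃ (Γ := Γ) (N := N) (κ := κ) assoc X Y Z
  simp only [inst, subst, catT, liftSub, instSub, weaken, rename] at h
  -- Computing the substitution exposed the renamings of `X` and `Y`; they are folded back into
  -- `weaken` so that the cancellation lemmas match.
  simp only [← weaken.eq_1, subst_liftSub_weaken_weaken, subst_instSub_weaken] at h
  exact h

theorem letters_lt {a b : Fin N} (hab : a < b) (X Y Z : Tm N κ Γ Ty.sym) :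
    Prov (neg (eq (catT (catT X (letterT a)) Y) (catT (catT X (letterT b)) Z))) := by
  have h := all_elim₃ (Γ := Γ) (N := N) (κ := κ) (letters a b hab) X Y Z
  simp only [inst, subst, subst_neg, catT, letterT, liftSub, instSub, weaken, rename] at h
  simp only [← weaken.eq_1, subst_liftSub_weaken_weaken, subst_instSub_weaken] at h
  exact h

theorem letters_ne {a b : Fin N} (hab : a ≠ b) (X Y Z : Tm N κ Γ Ty.sym) :
    Prov (neg (eq (catT (catT X (letterT a)) Y) (catT (catT X (letterT b)) Z))) := by
  rcases hab.lt_or_gt with h | h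
  · exact letters_lt h X Y Z
  · exact ne_symm (letters_lt h X Z Y)

/-- The word term of a single letter has no trailing empty word; the unit axiom makes the recursion
uniform. -/
theorem wordT_cons (a : Fin N) (w : List (Fin N)) :
    Prov (eq (wordT (a :: w)) (catT (letterT a) (wordT w) : Tm N κ Γ Ty.sym)) := by
  cases w with
  | nil => exact (cat_nil _).symm
  | cons b w => exact refl _

theorem wordT_append (u v : List (Fin N)) :
    Prov (eq (wordT (u ++ v)) (catT (wordT u) (wordT v) : Tm N κ Γ Ty.sym)) := by
  induction u with
  | nil => exact (nil_cat _).symm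
  | cons a u ih =>
    exact (wordT_cons a _).trans ((congr_cat (refl _) ih).trans
      ((cat_assoc _ _ _).symm.trans (congr_cat (wordT_cons a u).symm (refl _))))

theorem wordT_append_cons (x y : List (Fin N)) (a : Fin N) :
    Prov (eq (wordT (x ++ a :: y))
      (catT (catT (wordT x) (letterT a)) (wordT y) : Tm N κ Γ Ty.sym)) :=
  (wordT_append x (a :: y)).trans
    ((congr_cat (refl _) (wordT_cons a y)).trans (cat_assoc _ _ _).symm)

theorem congr_ne {A A' B B' : Tm N κ Γ α} (hA : Prov (eq A A')) (hB : Prov (eq B B'))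
    (h : Prov (neg (eq A' B'))) : Prov (neg (eq A B)) :=
  eq_mpr (congr_neg (congr_eq hA hB)) h

theorem wordT_ne_of_letter_ne {a b : Fin N} (hab : a ≠ b) (x y z : List (Fin N)) :
    Prov (neg (eq (wordT (x ++ a :: y)) (wordT (x ++ b :: z))) : Tm N κ Γ .truth) :=
  congr_ne (wordT_append_cons x y a) (wordT_append_cons x z b) (letters_ne hab _ _ _)

/-- The letter axioms only separate words that differ at a letter. Appending a letter b ≠ a to both
sides creates such a difference: x b and x a y b differ right after x. The existence of `a` and `N ≠
1` provide b; with a single letter, the letter axioms are void. -/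
theorem wordT_ne_of_prefix (hN : N ≠ 1) (x y : List (Fin N)) (a : Fin N) :
    Prov (neg (eq (wordT x) (wordT (x ++ a :: y))) : Tm N κ Γ .truth) := by
  have : Nontrivial (Fin N) := by
    have := a.pos
    exact Fin.nontrivial_iff_two_le.mpr (by omega)
  obtain ⟨b, hb⟩ := exists_ne a
  have hF : ∀ w : List (Fin N), Prov (eq
      (app (lam (catT (bound .here) (letterT b))) (wordT w) : Tm N κ Γ Ty.sym)
      (wordT (w ++ [b]))) := fun w =>
    (beta_congr (D := catT (wordT w) (letterT b)) rfl).trans (wordT_append w [b]).symm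
  refine contrapose (eq_imp_app _ _ _) (congr_ne (hF _) (hF _) ?_)
  rw [List.append_assoc]
  exact wordT_ne_of_letter_ne hb x [] (y ++ [b])

end Prov

/-- Two distinct words differ at a letter, or one is a proper prefix of the other. -/
theorem exists_prefix_or_letter_ne {τ : Type*} : ∀ {u v : List τ}, u ≠ v →
    (∃ a y, v = u ++ a :: y) ∨ (∃ a y, u = v ++ a :: y) ∨
      ∃ x a b y z, a ≠ b ∧ u = x ++ a :: y ∧ v = x ++ b :: z
  | [], [], h => absurd rfl h
  | [], b :: v, _ => .inl ⟨b, v, rfl⟩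
  | a :: u, [], _ => .inr (.inl ⟨a, u, rfl⟩)
  | a :: u, b :: v, h => by
    by_cases hab : a = b
    · subst hab
      rcases exists_prefix_or_letter_ne (u := u) (v := v) (by simpa using h) with
        ⟨c, y, rfl⟩ | ⟨c, y, rfl⟩ | ⟨x, c, d, y, z, hcd, rfl, rfl⟩
      · exact .inl ⟨c, y, rfl⟩
      · exact .inr (.inl ⟨c, y, rfl⟩)
      · exact .inr (.inr ⟨a :: x, c, d, y, z, hcd, rfl, rfl⟩)
    · exact .inr (.inr ⟨[], a, b, u, v, hab, rfl, rfl⟩)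

namespace Prov

open Term

variable {n : ℕ} [NeZero n] {N : ℕ} {κ : Ty n → Type u} {Γ : List (Ty n)} {α β γ : Ty n}

theorem wordT_ne (hN : N ≠ 1) {u v : List (Fin N)} (h : u ≠ v) :
    Prov (neg (eq (wordT u) (wordT v)) : Tm N κ Γ .truth) := by
  rcases exists_prefix_or_letter_ne h with
    ⟨a, y, rfl⟩ | ⟨a, y, rfl⟩ | ⟨x, a, b, y, z, hab, rfl, rfl⟩
  · exact wordT_ne_of_prefix hN u y a
  · exact ne_symm (wordT_ne_of_prefix hN v y a)
  · exact wordT_ne_of_letter_ne hab x y z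

/-! ### Unfolding canonic terms -/

theorem cross_app (A : Tm N κ Γ (.fn α .truth)) (B : Tm N κ Γ (.fn β .truth))
    (X : Tm N κ Γ α) (Y : Tm N κ Γ β) :
    Prov (eq (app (app (cross A B) X) Y) (conj (app A X) (app B Y))) := by
  have h := beta_beta (conj (app (weaken (weaken A)) (bound (.there .here)))
    (app (weaken (weaken B)) (bound .here))) X Y
  simp only [inst, subst, subst_conj, liftSub, instSub, subst_liftSub_weaken_weaken,
    subst_instSub_weaken] at h
  exact h

theorem relOr_app (A B : Tm N κ Γ (.fn α (.fn β .truth))) (X : Tm N κ Γ α) (Y : Tm N κ Γ β) :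
    Prov (eq (app (app (relOr A B) X) Y) (disj (app (app A X) Y) (app (app B X) Y))) := by
  have h := beta_beta (disj
    (app (app (weaken (weaken A)) (bound (.there .here))) (bound .here))
    (app (app (weaken (weaken B)) (bound (.there .here))) (bound .here))) X Y
  simp only [inst, subst, subst_disj, liftSub, instSub, subst_liftSub_weaken_weaken,
    subst_instSub_weaken] at h
  exact h

theorem cross_eqTo_app (A X : Tm N κ Γ α) (B Y : Tm N κ Γ β) :
    Prov (eq (app (app (cross (eqTo A) (eqTo B)) X) Y) (conj (eq X A) (eq Y B))) :=
  (cross_app _ _ X Y).trans (congr_conj (eqTo_app X A) (eqTo_app Y B))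

theorem canonicTerm_nil_app (X : Tm N κ [] Ty.sym) (Y : Tm N κ [] α) :
    Prov (eq (app (app (canonicTerm []) X) Y) fls) :=
  beta_beta fls X Y

/-- A one-entry canonic term has no final disjunct F; adding it by a tautology gives one recursion
for all nonempty lists. -/
theorem canonicTerm_cons_app (p : List (Fin N) × Tm N κ [] α)
    (G : List (List (Fin N) × Tm N κ [] α)) (X : Tm N κ [] Ty.sym) (Y : Tm N κ [] α) :
    Prov (eq (app (app (canonicTerm (p :: G)) X) Y)
      (disj (conj (eq X (wordT p.1)) (eq Y p.2)) (app (app (canonicTerm G) X) Y))) := by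
  cases G with
  | nil =>
    refine (cross_eqTo_app _ X _ Y).trans (Prov.trans ?_
      (congr_disj (refl _) (canonicTerm_nil_app X Y).symm))
    exact taut (.iff (.var 0) (.disj (.var 0) .fls)) ![_] (by decide)
  | cons q G => exact (relOr_app _ _ X Y).trans (congr_disj (cross_eqTo_app _ X _ Y) (refl _))

end Prov

end TyN

namespace TyN

/-! ### The standard model over the free monoid, and consistency -/

/-- The standard domains: words for the individuals of every sort. -/
def Dom (N : ℕ) {n : ℕ} : Ty n → Type
  | .truth => Prop
  | .ind _ => List (Fin N)
  | .fn α β => Dom N α → Dom N β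
  | .prod α β => Dom N α × Dom N β

instance Dom.instNonempty (N : ℕ) {n : ℕ} : ∀ α : Ty n, Nonempty (Dom N α)
  | .truth => ⟨True⟩
  | .ind _ => ⟨([] : List (Fin N))⟩
  | .fn _ β => ⟨fun _ => (Dom.instNonempty N β).some⟩
  | .prod α β => ⟨((Dom.instNonempty N α).some, (Dom.instNonempty N β).some)⟩

variable {n : ℕ} [NeZero n] {N : ℕ} {κ : Ty n → Type u}

/-- Values for the bound variables. -/
abbrev Env (N : ℕ) {n : ℕ} (Γ : List (Ty n)) : Type := ∀ α, BVar Γ α → Dom N α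

def Env.cons {Γ : List (Ty n)} {γ : Ty n} (d : Dom N γ) (e : Env N Γ) : Env N (γ :: Γ)
  | _, .here => d
  | _, .there x => e _ x

noncomputable def Const.den : ∀ {α : Ty n}, Const N κ α → Dom N α
  | _, .nil => ([] : List (Fin N))
  | _, .letter a => [a]
  | _, .cat => fun x y : List (Fin N) => x ++ y
  | α, .other _ => Classical.choice (Dom.instNonempty N α)

/-- No axiom constrains the free variables or the further constants, so one arbitrary value of each
type serves for all of them. -/
noncomputable def Term.den : ∀ {Γ : List (Ty n)} {α : Ty n}, Tm N κ Γ α → Env N Γ → Dom N α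
  | _, _, .bound x, e => e _ x
  | _, _, .free α _, _ => Classical.choice (Dom.instNonempty N α)
  | _, _, .const c, _ => c.den
  | _, _, .iota α, _ => fun p : Dom N α → Prop =>
      @Classical.epsilon _ (Dom.instNonempty N α) p
  | _, _, .app A B, e => A.den e (B.den e)
  | _, _, .lam A, e => fun d => A.den (e.cons d)
  | _, _, .eq A B, e => A.den e = B.den e
  | _, _, .pair A B, e => (A.den e, B.den e)
  | _, _, .fst A, e => (A.den e).1
  | _, _, .snd A, e => (A.den e).2

namespace Term

theorem den_rename {Γ Δ : List (Ty n)} {α : Ty n} (ρ : ∀ α, BVar Γ α → BVar Δ α)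
    (A : Tm N κ Γ α) (e : Env N Δ) : (A.rename ρ).den e = A.den fun α x => e α (ρ α x) := by
  induction A generalizing Δ with
  | lam A ih =>
    simp only [rename, den, ih]
    funext d
    congr 1
    funext β x
    cases x <;> rfl
  | _ => simp_all [rename, den] <;> rfl

@[simp]
theorem den_weaken {Γ : List (Ty n)} {α γ : Ty n} (A : Tm N κ Γ α) (d : Dom N γ)
    (e : Env N Γ) : (weaken A).den (e.cons d) = A.den e :=
  den_rename _ A _

theorem den_subst {Γ Δ : List (Ty n)} {α : Ty n} (σ : ∀ α, BVar Γ α → Tm N κ Δ α)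
    (A : Tm N κ Γ α) (e : Env N Δ) : (A.subst σ).den e = A.den fun α x => (σ α x).den e := by
  induction A generalizing Δ with
  | lam A ih =>
    simp only [subst, den, ih]
    funext d
    congr 1
    funext β x
    cases x
    · rfl
    · exact den_weaken _ _ _
  | _ => simp_all [subst, den] <;> rfl

theorem den_inst {Γ : List (Ty n)} {α γ : Ty n} (A : Tm N κ (γ :: Γ) α) (B : Tm N κ Γ γ)
    (e : Env N Γ) : (A.inst B).den e = A.den (e.cons (B.den e)) := by
  rw [inst, den_subst]
  congr 1
  funext β x
  cases x <;> rfl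

variable {Γ : List (Ty n)} (e : Env N Γ)

theorem den_tru : (tru : Tm N κ Γ .truth).den e = True :=
  eq_self _

theorem den_all {α : Ty n} (A : Tm N κ (α :: Γ) .truth) :
    (all A).den e = ∀ d : Dom N α, A.den (e.cons d) := by
  refine propext ⟨fun h d => ?_, fun h => ?_⟩
  · exact (congrFun (show (fun d => tru.den (e.cons d)) = fun d => A.den (e.cons d) from h) d).mp
      rfl
  · exact _root_.funext fun d => (den_tru _).trans (eq_true (h d)).symm

theorem den_fls : (fls : Tm N κ Γ .truth).den e = False := by
  rw [fls, den_all]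
  exact propext ⟨fun h => h False, False.elim⟩

theorem den_neg (A : Tm N κ Γ .truth) : (neg A).den e = ¬ A.den e := by
  refine Eq.trans (b := (fls : Tm N κ Γ .truth).den e = A.den e) rfl ?_
  rw [den_fls]
  exact propext ⟨fun h hA => h.mpr hA, fun h => (eq_false h).symm⟩

theorem den_conj (A B : Tm N κ Γ .truth) : (conj A B).den e = (A.den e ∧ B.den e) := by
  refine propext ⟨fun h => ?_, fun h => ?_⟩
  · have h1 : ∀ g : Prop → Prop → Prop, g True True = g (A.den e) (B.den e) := by
      intro g
      have hg : g (tru.den _) (tru.den _) = g (A.den e) (B.den e) := congrFun h g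
      rwa [den_tru] at hg
    exact (h1 And).mp ⟨trivial, trivial⟩
  · refine _root_.funext fun g : Prop → Prop → Prop => ?_
    show g _ _ = g _ _
    congr 1
    · exact (den_tru _).trans (eq_true h.1).symm
    · exact (den_tru _).trans (eq_true h.2).symm

theorem den_imp (A B : Tm N κ Γ .truth) : (imp A B).den e = (A.den e → B.den e) := by
  refine Eq.trans (b := (A.den e = (conj (bound (.there .here)) (bound .here) :
    Tm N κ (.truth :: .truth :: Γ) .truth).den ((e.cons (A.den e)).cons (B.den e)))) rfl ?_
  rw [den_conj]
  exact propext ⟨fun h hA => (h.mp hA : A.den e ∧ B.den e).2,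
    fun h => propext ⟨fun hA => ⟨hA, h hA⟩, And.left⟩⟩

end Term

open Term

/-- The two terms must agree in every environment, since the replaced occurrence may lie under
binders that capture their variables. -/
theorem Repl.den_eq {Γ₀ : List (Ty n)} {α : Ty n} {A B : Tm N κ Γ₀ α}
    (h : ∀ e : Env N Γ₀, A.den e = B.den e) {Γ : List (Ty n)} {β : Ty n} {D E : Tm N κ Γ β}
    (r : Repl A B D E) (e : Env N Γ) : D.den e = E.den e := by
  induction r with
  | here => exact h e
  | lam _ ih => exact funext fun d => ih _
  | _ => simp_all [Term.den] <;> rfl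

theorem Prov.sound {Γ : List (Ty n)} {A : Tm N κ Γ .truth} (h : Prov A) (e : Env N Γ) :
    A.den e := by
  induction h with
  | bool G =>
    show Term.den _ e = Term.den _ e
    rw [den_conj, den_all]
    simp only [Term.den, den_weaken, den_tru, den_fls]
    refine propext ⟨fun h (d : Prop) => ?_, fun h => ⟨h True, h False⟩⟩
    by_cases hd : d
    · obtain rfl := eq_true hd
      exact h.1
    · obtain rfl := eq_false hd
      exact h.2
  | leibniz A B H =>
    rw [den_imp]
    intro h
    exact congrArg (H.den e) h
  | funext F G =>
    show Term.den _ e = Term.den _ e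
    rw [den_all]
    simp only [Term.den, den_weaken]
    exact propext ⟨fun h d => congrFun h d, fun h => _root_.funext h⟩
  | beta A B => exact (den_inst A B e).symm
  | descr A =>
    show @Classical.epsilon _ _ (fun d => (weaken A).den (e.cons d) = d) = A.den e
    simp only [den_weaken]
    exact (@Classical.epsilon_spec _ (fun d => A.den e = d) ⟨_, rfl⟩).symm
  | fst_pair A B => rfl
  | snd_pair A B => rfl
  | pair_eta A => rfl
  | unit =>
    rw [den_all]
    intro d
    rw [den_conj]
    exact ⟨List.append_nil (α := Fin N) d, List.nil_append (α := Fin N) d⟩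
  | assoc =>
    simp only [den_all]
    exact fun x y z => List.append_assoc (α := Fin N) x y z
  | letters a b hab =>
    simp only [den_all, den_neg]
    have key : ∀ x y z : List (Fin N), x ++ [a] ++ y ≠ x ++ [b] ++ z := fun x y z h =>
      hab.ne (by simpa using h : a = b ∧ y = z).1
    exact fun x y z h => key x y z h
  | ruleR _ _ r ihAB ihD => exact (r.den_eq ihAB e).mp (ihD e)

theorem not_prov_fls : ¬ Prov (fls : Tm N κ [] .truth) := fun h => by
  have := h.sound fun _ x => nomatch x
  rwa [den_fls] at this

end TyN

namespace TyN

/-! ### Substitution of terms for constants -/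

variable {n : ℕ} [NeZero n] {N : ℕ} {κ : Ty n → Type u} {κ' : Ty n → Type v}

/-- A choice of a term over `κ'`, in every context, for each constant of `κ`. -/
abbrev ConstSub (N : ℕ) (κ : Ty n → Type u) (κ' : Ty n → Type v) : Type (max u v) :=
  ∀ (Γ : List (Ty n)) (α : Ty n), κ α → Tm N κ' Γ α

/-- The chosen terms are closed. -/
def ConstSub.Closed (g : ConstSub N κ κ') : Prop :=
  ∀ (Γ Δ : List (Ty n)) (σ : ∀ α, BVar Γ α → Tm N κ' Δ α) (α : Ty n) (c : κ α),
    (g Γ α c).subst σ = g Δ α c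

def Const.bind (g : ConstSub N κ κ') (Γ : List (Ty n)) : ∀ {α : Ty n}, Const N κ α → Tm N κ' Γ α
  | _, .nil => .const .nil
  | _, .letter a => .const (.letter a)
  | _, .cat => .const .cat
  | _, .other c => g Γ _ c

def Term.bindConst (g : ConstSub N κ κ') :
    ∀ {Γ : List (Ty n)} {α : Ty n}, Tm N κ Γ α → Tm N κ' Γ α
  | _, _, .bound x => .bound x
  | _, _, .free α i => .free α i
  | _, _, .const c => c.bind g _
  | _, _, .iota α => .iota α
  | _, _, .app A B => .app (A.bindConst g) (B.bindConst g)
  | _, _, .lam A => .lam (A.bindConst g)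
  | _, _, .eq A B => .eq (A.bindConst g) (B.bindConst g)
  | _, _, .pair A B => .pair (A.bindConst g) (B.bindConst g)
  | _, _, .fst A => .fst (A.bindConst g)
  | _, _, .snd A => .snd (A.bindConst g)

namespace ConstSub.Closed

open Term

variable {g : ConstSub N κ κ'} {Γ Δ : List (Ty n)} {α β γ : Ty n}

theorem bind_subst (hg : g.Closed) (σ : ∀ α, BVar Γ α → Tm N κ' Δ α) (c : Const N κ α) :
    (c.bind g Γ).subst σ = c.bind g Δ := by
  cases c with
  | other c => exact hg _ _ _ _ c
  | _ => rfl

theorem bindConst_rename (hg : g.Closed) (ρ : ∀ α, BVar Γ α → BVar Δ α) (A : Tm N κ Γ α) :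
    (A.rename ρ).bindConst g = (A.bindConst g).rename ρ := by
  induction A generalizing Δ with
  | const c =>
    -- A renaming is a substitution of variables, so invariance under substitution covers it.
    rw [rename_eq_subst ρ (bindConst g _)]
    exact (hg.bind_subst _ c).symm
  | _ => simp_all [rename, bindConst]

theorem bindConst_weaken (hg : g.Closed) (A : Tm N κ Γ α) :
    (weaken (γ := γ) A).bindConst g = weaken (A.bindConst g) :=
  hg.bindConst_rename _ A

theorem bindConst_subst (hg : g.Closed) (σ : ∀ α, BVar Γ α → Tm N κ Δ α)
    (A : Tm N κ Γ α) :
    (A.subst σ).bindConst g = (A.bindConst g).subst fun α x => (σ α x).bindConst g := by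
  induction A generalizing Δ with
  | const c => exact (hg.bind_subst _ c).symm
  | lam A ih =>
    simp only [subst, bindConst, ih]
    congr 2
    funext α x
    cases x
    · rfl
    · exact hg.bindConst_weaken _
  | _ => simp_all [subst, bindConst]

theorem bindConst_inst (hg : g.Closed) (A : Tm N κ (γ :: Γ) α) (B : Tm N κ Γ γ) :
    (A.inst B).bindConst g = (A.bindConst g).inst (B.bindConst g) := by
  rw [inst, inst, hg.bindConst_subst]
  congr 1
  funext α x
  cases x <;> rfl

theorem repl_bindConst {Γ₀ : List (Ty n)} {A B : Tm N κ Γ₀ α} {D E : Tm N κ Γ β}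
    (r : Repl A B D E) :
    Repl (A.bindConst g) (B.bindConst g) (D.bindConst g) (E.bindConst g) := by
  induction r with
  | here => exact .here
  | appL _ _ ih => exact .appL _ ih
  | appR _ _ ih => exact .appR _ ih
  | lam _ ih => exact .lam ih
  | eqL _ _ ih => exact .eqL _ ih
  | eqR _ _ ih => exact .eqR _ ih
  | pairL _ _ ih => exact .pairL _ ih
  | pairR _ _ ih => exact .pairR _ ih
  | fst _ ih => exact .fst ih
  | snd _ ih => exact .snd ih

/-- Provability is preserved when closed terms are put for constants. -/
theorem prov_bindConst (hg : g.Closed) {A : Tm N κ Γ .truth} (h : Prov A) :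
    Prov (A.bindConst g) := by
  induction h with
  | bool G =>
    have h := Prov.bool (G.bindConst g)
    rw [← hg.bindConst_weaken] at h
    exact h
  | leibniz A B H => exact .leibniz (A.bindConst g) (B.bindConst g) (H.bindConst g)
  | funext F G =>
    have h := Prov.funext (F.bindConst g) (G.bindConst g)
    rw [← hg.bindConst_weaken, ← hg.bindConst_weaken] at h
    exact h
  | beta A B =>
    have h := Prov.beta (A.bindConst g) (B.bindConst g)
    rw [← hg.bindConst_inst] at h
    exact h
  | descr A =>
    have h := Prov.descr (A.bindConst g)
    rw [← hg.bindConst_weaken] at h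
    exact h
  | fst_pair A B => exact .fst_pair _ _
  | snd_pair A B => exact .snd_pair _ _
  | pair_eta A => exact .pair_eta _
  | unit => exact .unit
  | assoc => exact .assoc
  | letters a b hab => exact .letters a b hab
  | ruleR _ _ r ihAB ihD => exact .ruleR ihAB ihD (repl_bindConst r)

end ConstSub.Closed

/-! ### Extensions by constants are conservative -/

section Extension

open Term

variable (ξ : Ty n → Type v) {Γ : List (Ty n)} {α : Ty n}

/-- The inclusion of the constants in an extension. -/
def extSub : ConstSub N κ (extend κ ξ) := fun _ _ c => .const (.other (.inl c))

/-- The retraction of an extension, which puts undefined descriptions for the new constants. -/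
def retractSub : ConstSub N (extend κ ξ) κ
  | _, _, .inl c => .const (.other c)
  | _, α, .inr _ => .app (.iota α) (.lam .fls)

theorem extSub_closed : (extSub ξ : ConstSub N κ _).Closed := fun _ _ _ _ _ => rfl

theorem retractSub_closed : (retractSub ξ : ConstSub N _ κ).Closed := by
  rintro _ _ _ _ (_ | _) <;> rfl

theorem toExt_eq_bindConst (A : Tm N κ Γ α) : toExt ξ A = A.bindConst (extSub ξ) := by
  unfold toExt
  induction A with
  | const c => cases c <;> rfl
  | _ => simp_all [mapConst, bindConst]

theorem retract_toExt (A : Tm N κ Γ α) : (toExt ξ A).bindConst (retractSub ξ) = A := by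
  rw [toExt_eq_bindConst]
  induction A with
  | const c => cases c <;> rfl
  | _ => simp_all [bindConst]

/-- Both directions substitute closed terms for constants in a proof. The retraction undoes the
inclusion, and descriptions provide a closed term of every type for it to use. -/
theorem prov_toExt_iff (A : Tm N κ Γ .truth) : Prov (toExt ξ A) ↔ Prov A := by
  constructor
  · intro h
    have h' := (retractSub_closed ξ).prov_bindConst h
    rwa [retract_toExt] at h'
  · intro h
    rw [toExt_eq_bindConst]
    exact (extSub_closed ξ).prov_bindConst h

theorem toExt_weaken {γ : Ty n} (A : Tm N κ Γ α) :
    toExt ξ (weaken (γ := γ) A) = weaken (toExt ξ A) := by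
  simp only [toExt_eq_bindConst, (extSub_closed ξ).bindConst_weaken]

theorem toExt_wordT : ∀ w : List (Fin N), toExt ξ (wordT w : Tm N κ Γ _) = wordT w
  | [] => rfl
  | [_] => rfl
  | a :: b :: w => congrArg (catT (letterT a)) (toExt_wordT (b :: w))

theorem toExt_eqTo (A : Tm N κ Γ α) : toExt ξ (eqTo A) = eqTo (toExt ξ A) := by
  unfold eqTo
  rw [← toExt_weaken]
  rfl

theorem toExt_cross {β : Ty n} (A : Tm N κ Γ (.fn α .truth)) (B : Tm N κ Γ (.fn β .truth)) :
    toExt ξ (cross A B) = cross (toExt ξ A) (toExt ξ B) := by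
  unfold cross
  simp only [← toExt_weaken]
  rfl

theorem toExt_relOr {β : Ty n} (A B : Tm N κ Γ (.fn α (.fn β .truth))) :
    toExt ξ (relOr A B) = relOr (toExt ξ A) (toExt ξ B) := by
  unfold relOr predOr
  rw [← toExt_weaken ξ A, ← toExt_weaken ξ B]
  refine congrArg Term.lam (congrArg Term.lam ?_)
  exact congrArg₂ (fun P Q => disj (app P (bound .here)) (app Q (bound .here)))
    (toExt_weaken ξ (app (weaken A) (bound .here)))
    (toExt_weaken ξ (app (weaken B) (bound .here)))

theorem toExt_canonicTerm : ∀ G : List (List (Fin N) × Tm N κ [] α),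
    toExt ξ (canonicTerm G) = canonicTermExt ξ G
  | [] => rfl
  | [p] => by
    simp only [canonicTermExt, canonicTerm, List.map, toExt_cross, toExt_eqTo, toExt_wordT]
  | p :: q :: G => by
    have ih := toExt_canonicTerm (q :: G)
    simp only [canonicTermExt, canonicTerm, List.map, toExt_cross, toExt_eqTo, toExt_wordT,
      toExt_relOr] at ih ⊢
    rw [ih]

theorem prov_canonicTermExt_iff (G : List (List (Fin N) × Tm N κ [] α)) (w : List (Fin N))
    (A : Tm N κ [] α) : Prov (app (app (canonicTermExt ξ G) (wordT w)) (toExt ξ A)) ↔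
      Prov (app (app (canonicTerm G) (wordT w)) A) := by
  rw [← prov_toExt_iff ξ (app (app (canonicTerm G) (wordT w)) A), ← toExt_canonicTerm,
    ← toExt_wordT ξ w]
  rfl

end Extension

/-! ### The language of a canonic term -/

section Canonic

open Term Prov

variable {α : Ty n}

/-- The disjunction of the equations `A = B`, for `B` in a list. -/
def eqAny (A : Tm N κ [] α) : List (Tm N κ [] α) → Tm N κ [] .truth
  | [] => fls
  | B :: l => disj (eq A B) (eqAny A l)

theorem prov_eq_imp_eqAny_eq (A D : Tm N κ [] α) (l : List (Tm N κ [] α)) :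
    Prov (imp (eq A D) (eq (eqAny A l) (eqAny D l))) := by
  induction l with
  | nil => exact taut (.imp (.var 0) (.iff .fls .fls)) ![_] (by decide)
  | cons B l ih =>
    exact ((taut (.imp (.imp (.var 0) (.iff (.var 1) (.var 2))) (.imp
      (.imp (.var 0) (.iff (.var 3) (.var 4)))
      (.imp (.var 0) (.iff (.disj (.var 1) (.var 3)) (.disj (.var 2) (.var 4))))))
      ![eq A D, eq A B, eq D B, eqAny A l, eqAny D l] (by decide)).mp
        (eq_imp_eq A D B)).mp ih

/-- A logically closed language is closed under disjunctions of any finite length. -/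
theorem LogicallyClosed.mem_of_eqAny {M : Lang N κ α} (hM : LogicallyClosed M)
    (w : List (Fin N)) (l : List (Tm N κ [] α)) (hl : ∀ B ∈ l, (w, B) ∈ M) (A : Tm N κ [] α)
    (h : Prov (eqAny A l)) : (w, A) ∈ M := by
  induction l generalizing A with
  -- The empty disjunction is F, so consistency is what is needed here.
  | nil => exact absurd h not_prov_fls
  | cons B l ih =>
    have hB := hl B (by simp)
    cases l with
    | nil =>
      exact hM w A B B hB hB ((taut (.imp (.disj (.var 0) .fls) (.disj (.var 0) (.var 0)))
        ![eq A B] (by decide)).mp h)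
    | cons B' l =>
      -- `D` is `A` if `A` equals one of the terms in `B' :: l`, and `B'` otherwise. Either way `D`
      -- equals one of these terms, while `A` equals `B` or `D`; so the disjunction is shortened to
      -- two members.
      obtain ⟨D, hD, hD'⟩ := exists_ite (eqAny A (B' :: l)) A B'
      have hDM : (w, D) ∈ M := by
        refine ih (fun E hE => hl E (List.mem_cons_of_mem _ hE)) D ?_
        exact (((taut (.imp (.imp (.var 0) (.var 1)) (.imp (.imp (.neg (.var 0)) (.var 2))
          (.imp (.imp (.var 1) (.iff (.var 0) (.disj (.var 2) (.var 3))))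
            (.disj (.var 2) (.var 3))))) ![eqAny A (B' :: l), eq A D, eq D B', eqAny D l]
          (by decide)).mp hD).mp hD').mp (prov_eq_imp_eqAny_eq A D (B' :: l))
      exact hM w A B D hB hDM (((taut (.imp (.imp (.var 0) (.var 1)) (.imp
        (.disj (.var 2) (.var 0)) (.disj (.var 2) (.var 1))))
        ![eqAny A (B' :: l), eq A D, eq A B] (by decide)).mp hD).mp h)

/-- An entry for another word contributes a disjunct whose word equation is refutable by `wordT_ne`;
an entry for `w` contributes its equation for `A`. -/
theorem prov_canonicTerm_imp_eqAny (hN : N ≠ 1) (G : List (List (Fin N) × Tm N κ [] α))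
    (w : List (Fin N)) (A : Tm N κ [] α) :
    Prov (imp (app (app (canonicTerm G) (wordT w)) A)
      (eqAny A ((G.filter fun p => p.1 = w).map Prod.snd))) := by
  induction G with
  | nil =>
    exact eq_mpr (congr_imp (canonicTerm_nil_app _ _) (refl _)) (fls_imp _)
  | cons p G ih =>
    refine eq_mpr (congr_imp (canonicTerm_cons_app p G _ A) (refl _)) ?_
    by_cases hp : p.1 = w
    · rw [List.filter_cons_of_pos (by simpa using hp)]
      exact (taut (.imp (.imp (.var 2) (.var 3)) (.imp (.disj (.conj (.var 0) (.var 1)) (.var 2))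
        (.disj (.var 1) (.var 3)))) ![_, eq A p.2, _, _] (by decide)).mp ih
    · rw [List.filter_cons_of_neg (by simpa using hp)]
      exact ((taut (.imp (.neg (.var 0)) (.imp (.imp (.var 2) (.var 3))
        (.imp (.disj (.conj (.var 0) (.var 1)) (.var 2)) (.var 3))))
        ![eq (wordT w) (wordT p.1), eq A p.2, app (app (canonicTerm G) (wordT w)) A, eqAny A _]
        (by decide)).mp (wordT_ne hN (Ne.symm hp))).mp ih

theorem LogicallyClosed.mem_of_prov_canonicTerm (hN : N ≠ 1) {M : Lang N κ α}
    (hM : LogicallyClosed M) {G : List (List (Fin N) × Tm N κ [] α)} (hG : {p | p ∈ G} ⊆ M)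
    {w : List (Fin N)} {A : Tm N κ [] α}
    (h : Prov (app (app (canonicTerm G) (wordT w)) A)) : (w, A) ∈ M := by
  refine hM.mem_of_eqAny w _ (fun B hB => ?_) A ((prov_canonicTerm_imp_eqAny hN G w A).mp h)
  obtain ⟨⟨w', B'⟩, hp, rfl⟩ := List.mem_map.mp hB
  obtain ⟨hp', hw⟩ := List.mem_filter.mp hp
  obtain rfl : w' = w := by simpa using hw
  exact hG hp'

theorem prov_canonicTerm_of_mem {G : List (List (Fin N) × Tm N κ [] α)}
    {p : List (Fin N) × Tm N κ [] α} (hp : p ∈ G) :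
    Prov (app (app (canonicTerm G) (wordT p.1)) p.2) := by
  induction G with
  | nil => simp at hp
  | cons q G ih =>
    refine eq_mpr (canonicTerm_cons_app q G _ _) ?_
    rcases List.mem_cons.mp hp with rfl | hp
    · exact ((taut (.imp (.var 0) (.imp (.var 1) (.disj (.conj (.var 0) (.var 1)) (.var 2))))
        ![eq (wordT p.1) (wordT p.1), eq p.2 p.2, app (app (canonicTerm G) (wordT p.1)) p.2]
        (by decide)).mp (Prov.refl _)).mp (Prov.refl _)
    · exact (taut (.imp (.var 1) (.disj (.var 0) (.var 1))) ![_, _] (by decide)).mp (ih hp)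

/-- This would hold for any relation term: by Leibniz's law each of A = B and A = D makes the
predicate at `A` equal to a provable one. -/
theorem logicallyClosed_canonicTerm (G : List (List (Fin N) × Tm N κ [] α)) :
    LogicallyClosed {p : List (Fin N) × Tm N κ [] α |
      Prov (app (app (canonicTerm G) (wordT p.1)) p.2)} := by
  intro w A B D hB hD h
  let R := app (canonicTerm G) (wordT w)
  exact (((((taut (.imp (.imp (.var 0) (.iff (.var 2) (.var 3))) (.imp
    (.imp (.var 1) (.iff (.var 2) (.var 4))) (.imp (.var 3) (.imp (.var 4)
      (.imp (.disj (.var 0) (.var 1)) (.var 2))))))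
    ![eq A B, eq A D, app R A, app R B, app R D] (by decide)).mp
    (leibniz A B R)).mp (leibniz A D R)).mp hB).mp hD).mp h

theorem isLogicalClosure_canonicTerm (hN : N ≠ 1) (G : List (List (Fin N) × Tm N κ [] α)) :
    IsLogicalClosure {p : List (Fin N) × Tm N κ [] α |
      Prov (app (app (canonicTerm G) (wordT p.1)) p.2)} {p | p ∈ G} :=
  ⟨⟨logicallyClosed_canonicTerm G, fun _ hp => prov_canonicTerm_of_mem hp⟩,
    fun _ hM _ hp => hM.1.mem_of_prov_canonicTerm hN hM.2 hp⟩

theorem IsLogicalClosure.represents (hN : N ≠ 1) (ξ : Ty n → Type v) {L : Lang N κ α}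
    {G : List (List (Fin N) × Tm N κ [] α)} (h : IsLogicalClosure L {p | p ∈ G}) :
    Represents ξ (canonicTermExt ξ G) L := by
  intro w A
  rw [prov_canonicTermExt_iff, IsLeast.unique h (isLogicalClosure_canonicTerm hN G)]
  rfl

end Canonic

end TyN

/-! ### Canonic representations and lexicons -/

theorem theorem6p4 {n : ℕ} [NeZero n] {N : ℕ} (hN : N ≠ 1) {κ : TyN.Ty n → Type u}
    (ξ : TyN.Ty n → Type v) {α : TyN.Ty n} (L : TyN.Lang N κ α)
    (hL : TyN.LogicallyClosed L) :
    (TyN.HasCanonicRep ξ L ↔ TyN.IsLexicon L) ∧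
      ∀ G : List (List (Fin N) × TyN.Tm N κ [] α),
        TyN.IsLogicalClosure L {p | p ∈ G} → TyN.Represents ξ (TyN.canonicTermExt ξ G) L := by
  refine ⟨⟨?_, ?_⟩, fun G hG => hG.represents hN ξ⟩
  · rintro ⟨R, hR, G, hRG⟩
    refine ⟨{p | p ∈ G}, G.finite_toSet, ?_⟩
    -- It remains to identify `L` with the language of the canonic term of `G`: `R` and that term
    -- are provably equal, hence hold provably of the same pairs, and conservativity removes the new
    -- constants.
    convert TyN.isLogicalClosure_canonicTerm hN G using 1
    ext ⟨w, A⟩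
    refine (hR w A).trans (Iff.trans ?_ (TyN.prov_canonicTermExt_iff ξ G w A))
    have h := (hRG.congr_app (.refl (TyN.wordT w))).congr_app (.refl (TyN.toExt ξ A))
    exact ⟨h.eq_mp, h.eq_mpr⟩
  · rintro ⟨S, hS, hLS⟩
    obtain ⟨G, rfl⟩ : ∃ G : List (List (Fin N) × TyN.Tm N κ [] α), {p | p ∈ G} = S :=
      ⟨hS.toFinset.toList, by ext; simp⟩
    exact ⟨_, hLS.represents hN ξ, G, .refl _⟩
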